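/- Let $G$ be a graph with vertex set $\mathbb{N}=\{1,2,\dots\}$ and let $\Lambda\subset\mathbb{R}$ be compact and infinite. A symmetric real matrix $A$ has the *weak spectral property* (WSP) if $X=O$ is the only real symmetric matrix with $X\circ I=O$ (entrywise product) and $XA-AX=O$. A matrix has graph $H$ if its off-diagonal $(i,j)$ entry is nonzero exactly when $i$ and $j$ are adjacent in $H$. Say that a bounded operator $T$ on the complex Hilbert space $\ell^2(\mathbb{N})$ is *produced by the construction with data $(G,\Lambda)$* if there are an enumeration without repetition $\lambda_1,\lambda_2,\dots$ of a countable dense subset of $\Lambda$ and real symmetric $n\times n$ matrices $A_n$ ($n\ge 1$) such that - the graph of $A_n$ is the subgraph of $G$ induced on $\{1,\dots,n\}$, $\sigma(A_n)=\{\lambda_1,\dots,\lambda_n\}$, and $A_n$ has the WSP; - $A_{n+1}$ differs from $A_n\oplus[\lambda_{n+1}]$ only on the diagonal and in the last row and column, and $\|A_n\oplus[\lambda_{n+1}]-A_{n+1}\|_{\mathrm{op}}<2^{-n}$; - $T=\lim_{n\to\infty}T_n$ in operator norm, where $T_n$ is the bounded operator with standard matrix $A_n\oplus\operatorname{diag}(\lambda_{n+1},\lambda_{n+2},\dots)$.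 Let $\Lambda'$ be the set of limit points of $\Lambda$ and let $\sigma_{\mathrm{ess}}(T)$ be the set of $z\in\mathbb{C}$ for which $T-zI$ is not Fredholm. Then for every $T$ produced by the construction with data $(G,\Lambda)$, $$\sigma(T)=\Lambda,\qquad \sigma(T)\setminus\sigma_{\mathrm{ess}}(T)=\Lambda\setminus\Lambda',$$ and every isolated point $\lambda\in\Lambda\setminus\Lambda'$ is an eigenvalue of $T$ of multiplicity exactly one, that is, $\dim\ker(T-\lambda I)=1$. -/

import Mathlib

open scoped Matrix

/-- A real square matrix has the *Weak Spectral Property* if `X = 0` is the only symmetric matrix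
with `X ∘ I = 0` (entrywise product) and `[X, A] = 0`. -/
def HasWSP {m : ℕ} (A : Matrix (Fin m) (Fin m) ℝ) : Prop :=
  ∀ X : Matrix (Fin m) (Fin m) ℝ,
    X.IsSymm → X ⊙ (1 : Matrix (Fin m) (Fin m) ℝ) = 0 → ⁅X, A⁆ = 0 → X = 0

/-- `H` is the graph of the matrix `A`: off the diagonal, an entry is nonzero exactly when the
corresponding vertices are adjacent. -/
def IsGraphOfMatrix {V : Type*} (H : SimpleGraph V) (A : Matrix V V ℝ) : Prop :=
  ∀ i j : V, i ≠ j → (A i j ≠ 0 ↔ H.Adj i j)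

/-- The induced subgraph of `G` on its first `m` vertices. -/
def initialSubgraph (G : SimpleGraph ℕ) (m : ℕ) : SimpleGraph (Fin m) :=
  G.comap (fun i : Fin m => (i : ℕ))

/-- The block diagonal matrix `A ⊕ [c]`. -/
def directSumScalar {m : ℕ} (A : Matrix (Fin m) (Fin m) ℝ) (c : ℝ) :
    Matrix (Fin (m + 1)) (Fin (m + 1)) ℝ :=
  Matrix.reindex finSumFinEquiv finSumFinEquiv
    (Matrix.fromBlocks A 0 0 (Matrix.of fun _ _ : Fin 1 => c))

/-- The operator norm of a real square matrix with respect to the Euclidean norm. -/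
noncomputable def matrixOpNorm {m : ℕ} (A : Matrix (Fin m) (Fin m) ℝ) : ℝ :=
  ‖Matrix.toEuclideanCLM (n := Fin m) (𝕜 := ℝ) A‖

/-- The infinite matrix `A ⊕ diag(lam m, lam (m + 1), …)`, where `A` is `m × m` (rows and columns
are numbered from `0`). -/
def extendByDiagonal {m : ℕ} (A : Matrix (Fin m) (Fin m) ℝ) (lam : ℕ → ℝ) : Matrix ℕ ℕ ℝ :=
  Matrix.of fun i j =>
    if h : i < m ∧ j < m then A ⟨i, h.1⟩ ⟨j, h.2⟩ else if i = j then lam i else 0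

/-- The complex Hilbert space of square-summable sequences. -/
abbrev EllTwo : Type := lp (fun _ : ℕ => ℂ) 2

/-- `M` is the standard matrix of `T`: the `j`-th column of `M` is `T e_j`, where `e_0, e_1, …` is
the standard Hilbert basis. -/
def HasStandardMatrix (T : EllTwo →L[ℂ] EllTwo) (M : Matrix ℕ ℕ ℝ) : Prop :=
  ∀ i j : ℕ, T (lp.single 2 j (1 : ℂ)) i = (M i j : ℂ)

/-- One run of the construction of an operator with graph `G` and spectrum `Λ`.

One enumerates, without repetition, a countable dense subset `{lam 0, lam 1, …}` of `Λ` and chooses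
symmetric matrices `A 0, A 1, …`, where `A n` has size `n + 1`, has as its graph the subgraph of
`G` induced on the first `n + 1` vertices, has spectrum `{lam 0, …, lam n}` and has the WSP.
The matrix `A (n + 1)` is obtained from `A n ⊕ [lam (n + 1)]` by changing only diagonal entries and
entries in the last row and column, with a change of operator norm less than `1 / 2 ^ (n + 1)`. -/
structure ConstructionData (G : SimpleGraph ℕ) (Λ : Set ℝ) where
  lam : ℕ → ℝ
  lam_injective : Function.Injective lam
  lam_mem : ∀ n, lam n ∈ Λ
  lam_dense : Λ ⊆ closure (Set.range lam)
  A : ∀ n : ℕ, Matrix (Fin (n + 1)) (Fin (n + 1)) ℝ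
  A_symm : ∀ n, (A n).IsSymm
  A_graph : ∀ n, IsGraphOfMatrix (initialSubgraph G (n + 1)) (A n)
  A_spectrum : ∀ n, spectrum ℝ (A n) = Set.range (fun i : Fin (n + 1) => lam i)
  A_wsp : ∀ n, HasWSP (A n)
  A_offDiag : ∀ n (i j : Fin (n + 1)), i ≠ j → A (n + 1) i.castSucc j.castSucc = A n i j
  A_close : ∀ n, matrixOpNorm (directSumScalar (A n) (lam (n + 1)) - A (n + 1)) < 1 / 2 ^ (n + 1)

/-- `T` is produced by the construction with data `(G, Λ)`: it is the limit, in operator norm, of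
the operators `S n` whose standard matrices are `A n ⊕ diag(lam (n + 1), lam (n + 2), …)`. -/
def IsConstructedSolution (G : SimpleGraph ℕ) (Λ : Set ℝ) (T : EllTwo →L[ℂ] EllTwo) : Prop :=
  ∃ (d : ConstructionData G Λ) (S : ℕ → EllTwo →L[ℂ] EllTwo),
    (∀ n, HasStandardMatrix (S n) (extendByDiagonal (d.A n) d.lam)) ∧
      Filter.Tendsto S Filter.atTop (nhds T)

/-- The essential spectrum: the `z : ℂ` for which `T - z I` is not a Fredholm operator. -/
def essentialSpectrum (T : EllTwo →L[ℂ] EllTwo) : Set ℂ :=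
  {z | ¬ (T - z • ContinuousLinearMap.id ℂ EllTwo).IsFredholm}

/-! Each approximant `S n` is self-adjoint and diagonal in an orthonormal basis `b n`, with the same
simple eigenvalues `lam i` for every `n`. The bases vary with `n` and are never shown to converge,
so only estimates uniform in `n` are passed to the limit `T`. Away from the closure of the
eigenvalues, a lower bound for `S n - z` survives when `‖S n - T‖` is smaller than it; each `lam i`
stays in the spectrum because nonunits form a closed set. At an isolated point, adding the
projection onto the corresponding eigenvector of a late `S n` makes `T - lam k` invertible. So `T -
lam k` is a rank one perturbation of a unit and itself not a unit: it is Fredholm with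
one-dimensional kernel. At a limit point, an infinite-dimensional space of approximate eigenvectors
rules out a quasi-inverse. -/

section DiagonalOperator

open Filter Topology InnerProductSpace

variable {H : Type*} [NormedAddCommGroup H] [InnerProductSpace ℂ H] {ι : Type*}

/-- The vectors of the Hilbert basis `b` are eigenvectors of `S`, with eigenvalues `c i`. -/
def IsDiagonalIn (S : H →L[ℂ] H) (b : HilbertBasis ι ℂ H) (c : ι → ℂ) : Prop :=
  ∀ i, S (b i) = c i • b i

/-! ### Norm estimates for diagonal operators -/

namespace IsDiagonalIn

variable {S : H →L[ℂ] H} {b : HilbertBasis ι ℂ H} {c : ι → ℂ}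

theorem inner_map (h : IsDiagonalIn S b c) (i : ι) (x : H) :
    inner ℂ (b i) (S x) = c i * inner ℂ (b i) x := by
  have key : (innerSL ℂ (b i)).comp S = c i • innerSL ℂ (b i) := by
    refine ContinuousLinearMap.ext_on (s := Set.range b) ?_ ?_
    · exact Submodule.dense_iff_topologicalClosure_eq_top.mpr b.dense_span
    · rintro _ ⟨j, rfl⟩
      classical
      by_cases hij : i = j
      · subst hij
        simp [h i]
      · simp [h j, b.orthonormal.2 hij]
  simpa using congr($key x)

theorem sub_smul (h : IsDiagonalIn S b c) (z : ℂ) :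
    IsDiagonalIn (S - z • ContinuousLinearMap.id ℂ H) b (fun i => c i - z) := by
  intro i
  simp [h i, _root_.sub_smul]

theorem add_rankOne [DecidableEq ι] (h : IsDiagonalIn S b c) (k : ι) :
    IsDiagonalIn (S + rankOne ℂ (b k) (b k)) b (fun i => c i + if i = k then 1 else 0) := by
  intro i
  by_cases hik : i = k
  · subst hik
    simp [h i, add_smul, inner_self_eq_norm_sq_to_K, b.orthonormal.1 i]
  · simp [h i, hik, b.orthonormal.2 (Ne.symm hik)]

theorem _root_.HilbertBasis.hasSum_norm_inner_sq (b : HilbertBasis ι ℂ H) (x : H) :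
    HasSum (fun i => ‖inner ℂ (b i) x‖ ^ 2) (‖x‖ ^ 2) := by
  have h := lp.hasSum_norm (p := 2) (by norm_num) (b.repr x)
  simpa [b.repr_apply_apply] using h

theorem mul_norm_le (h : IsDiagonalIn S b c) {δ : ℝ} (hδ : 0 ≤ δ) {x : H}
    (hc : ∀ i, inner ℂ (b i) x ≠ 0 → δ ≤ ‖c i‖) : δ * ‖x‖ ≤ ‖S x‖ := by
  refine le_of_sq_le_sq ?_ (norm_nonneg _)
  rw [mul_pow]
  refine hasSum_le (fun i => ?_) ((b.hasSum_norm_inner_sq x).mul_left (δ ^ 2))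
    (b.hasSum_norm_inner_sq (S x))
  rw [h.inner_map, norm_mul, mul_pow]
  by_cases hx : inner ℂ (b i) x = 0
  · simp [hx]
  · have := hc i hx
    gcongr

/-- Parseval, term by term. Bounding only the `c i` that `x` meets lets this apply to vectors in the
span of part of the basis. -/
theorem norm_le_mul (h : IsDiagonalIn S b c) {ε : ℝ} (hε : 0 ≤ ε) {x : H}
    (hc : ∀ i, inner ℂ (b i) x ≠ 0 → ‖c i‖ ≤ ε) : ‖S x‖ ≤ ε * ‖x‖ := by
  refine le_of_sq_le_sq ?_ (by positivity)
  rw [mul_pow]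
  refine hasSum_le (fun i => ?_) (b.hasSum_norm_inner_sq (S x))
    ((b.hasSum_norm_inner_sq x).mul_left (ε ^ 2))
  rw [h.inner_map, norm_mul, mul_pow]
  by_cases hx : inner ℂ (b i) x = 0
  · simp [hx]
  · have := hc i hx
    gcongr

end IsDiagonalIn

/-- A lower bound for an operator persists, slightly weakened, under small perturbations. -/
theorem ContinuousLinearMap.sub_mul_norm_le_of_mul_norm_le {S T : H →L[ℂ] H} {δ : ℝ}
    (h : ∀ x, δ * ‖x‖ ≤ ‖S x‖) (x : H) : (δ - ‖S - T‖) * ‖x‖ ≤ ‖T x‖ := by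
  have h1 : ‖S x‖ ≤ ‖(S - T) x‖ + ‖T x‖ := by
    simpa using norm_add_le ((S - T) x) (T x)
  have h2 := (S - T).le_opNorm x
  have h3 := h x
  linarith

/-- The bound on `S` gives injectivity and closed range; the bound on the adjoint makes the range
dense. -/
theorem ContinuousLinearMap.isUnit_of_bounded_below [CompleteSpace H] {S : H →L[ℂ] H} {δ δ' : ℝ}
    (hδ : 0 < δ) (h : ∀ x, δ * ‖x‖ ≤ ‖S x‖)
    (hδ' : 0 < δ') (h' : ∀ x, δ' * ‖x‖ ≤ ‖ContinuousLinearMap.adjoint S x‖) : IsUnit S := by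
  rw [isUnit_iff_bijective, bijective_iff_dense_range_and_antilipschitz]
  refine ⟨?_, ⟨⟨δ⁻¹, by positivity⟩, S.antilipschitz_of_bound fun x => ?_⟩⟩
  · rw [Submodule.topologicalClosure_eq_top_iff, ContinuousLinearMap.orthogonal_range,
      Submodule.eq_bot_iff]
    intro x hx
    have hx' : ContinuousLinearMap.adjoint S x = 0 := hx
    have := h' x
    rw [hx', norm_zero] at this
    exact norm_le_zero_iff.mp (nonpos_of_mul_nonpos_right this hδ')
  · have := h x
    change ‖x‖ ≤ δ⁻¹ * ‖S x‖
    rwa [inv_mul_eq_div, le_div_iff₀ hδ, mul_comm]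

theorem ContinuousLinearMap.adjoint_smul_id [CompleteSpace H] (z : ℂ) :
    ContinuousLinearMap.adjoint (z • ContinuousLinearMap.id ℂ H)
      = starRingEnd ℂ z • ContinuousLinearMap.id ℂ H := by
  rw [map_smulₛₗ, ContinuousLinearMap.adjoint_id]

/-! ### Norm limits of operators with common eigenvalues -/

section Limit

variable {S : ℕ → H →L[ℂ] H} {T : H →L[ℂ] H} {b : ℕ → HilbertBasis ι ℂ H} {lam : ι → ℝ}

theorem isSelfAdjoint_of_tendsto [CompleteSpace H] (hS : ∀ n, IsSelfAdjoint (S n))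
    (hT : Tendsto S atTop (𝓝 T)) : IsSelfAdjoint T := by
  refine isClosed_eq continuous_star continuous_id |>.mem_of_tendsto hT ?_
  exact Eventually.of_forall hS

/-- Points at positive distance from all eigenvalues are in the resolvent set of the limit. -/
theorem isUnit_sub_smul_of_tendsto [CompleteSpace H]
    (hSb : ∀ n, IsDiagonalIn (S n) (b n) (fun i => (lam i : ℂ)))
    (hTs : IsSelfAdjoint T) (hT : Tendsto S atTop (𝓝 T)) {z : ℂ} {δ : ℝ} (hδ : 0 < δ)
    (hz : ∀ i, δ ≤ ‖(lam i : ℂ) - z‖) : IsUnit (T - z • ContinuousLinearMap.id ℂ H) := by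
  obtain ⟨n, hn⟩ := ((tendsto_iff_norm_sub_tendsto_zero.mp hT).eventually_lt_const hδ).exists
  have key : ∀ w : ℂ, (∀ i, δ ≤ ‖(lam i : ℂ) - w‖) → ∀ x,
      (δ - ‖S n - T‖) * ‖x‖ ≤ ‖(T - w • ContinuousLinearMap.id ℂ H) x‖ := by
    intro w hw x
    have := ContinuousLinearMap.sub_mul_norm_le_of_mul_norm_le
      (T := T - w • ContinuousLinearMap.id ℂ H)
      (fun x => ((hSb n).sub_smul w).mul_norm_le hδ.le (x := x) fun i _ => hw i) x
    rwa [sub_sub_sub_cancel_right] at this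
  refine ContinuousLinearMap.isUnit_of_bounded_below (sub_pos.mpr hn) (key z hz)
    (sub_pos.mpr hn) ?_
  have hadj : ContinuousLinearMap.adjoint (T - z • ContinuousLinearMap.id ℂ H)
      = T - (starRingEnd ℂ z) • ContinuousLinearMap.id ℂ H := by
    rw [map_sub, hTs.adjoint_eq, ContinuousLinearMap.adjoint_smul_id]
  rw [hadj]
  -- The `lam i` are real, hence equally far from `z` and from its conjugate.
  refine key _ fun i => ?_
  have : (lam i : ℂ) - starRingEnd ℂ z = starRingEnd ℂ ((lam i : ℂ) - z) := by simp
  rw [this, RCLike.norm_conj]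
  exact hz i

/-- Each common eigenvalue is in the spectrum of the limit. -/
theorem not_isUnit_sub_smul_of_tendsto [CompleteSpace H]
    (hSb : ∀ n, IsDiagonalIn (S n) (b n) (fun i => (lam i : ℂ)))
    (hT : Tendsto S atTop (𝓝 T)) (i : ι) :
    ¬ IsUnit (T - (lam i : ℂ) • ContinuousLinearMap.id ℂ H) := by
  refine nonunits.isClosed.mem_of_tendsto (hT.sub_const _) (Eventually.of_forall fun n hu => ?_)
  have hinj := (ContinuousLinearMap.isUnit_iff_bijective.mp hu).1
  have h0 : b n i = 0 := hinj (by simp [hSb n i])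
  simpa [h0] using (b n).orthonormal.1 i

/-- At an isolated simple eigenvalue, the limit is a rank one perturbation of a unit. -/
theorem exists_isUnit_sub_rankOne_of_tendsto [CompleteSpace H]
    (hSb : ∀ n, IsDiagonalIn (S n) (b n) (fun i => (lam i : ℂ)))
    (hTs : IsSelfAdjoint T) (hT : Tendsto S atTop (𝓝 T)) {k : ι} {δ : ℝ} (hδ : 0 < δ)
    (hk : ∀ i ≠ k, δ ≤ |lam i - lam k|) :
    ∃ (E : H →L[ℂ] H) (u : H), IsUnit E ∧
      T - (lam k : ℂ) • ContinuousLinearMap.id ℂ H = E - rankOne ℂ u u := by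
  classical
  -- After adding the projection, the `k`-th eigenvalue of `S n - lam k` is 1 and the others have
  -- modulus at least `δ`.
  set η := min δ 1 with hη
  have hηpos : 0 < η := lt_min hδ one_pos
  obtain ⟨n, hn⟩ := ((tendsto_iff_norm_sub_tendsto_zero.mp hT).eventually_lt_const hηpos).exists
  set u := b n k
  set E := T - (lam k : ℂ) • ContinuousLinearMap.id ℂ H + rankOne ℂ u u with hE
  have hEs : ContinuousLinearMap.adjoint E = E := by
    rw [hE, map_add, map_sub, hTs.adjoint_eq, ContinuousLinearMap.adjoint_smul_id,
      Complex.conj_ofReal, adjoint_rankOne]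
  have hlow : ∀ x, (η - ‖S n - T‖) * ‖x‖ ≤ ‖E x‖ := by
    intro x
    have hd := ((hSb n).sub_smul (lam k)).add_rankOne k
    have := ContinuousLinearMap.sub_mul_norm_le_of_mul_norm_le (T := E) (δ := η)
      (fun x => hd.mul_norm_le hηpos.le (x := x) fun i _ => ?_) x
    · rwa [hE, add_sub_add_right_eq_sub, sub_sub_sub_cancel_right] at this
    · by_cases hik : i = k
      · simp [hik, hη]
      · have h1 := hk i hik
        simp only [hik, if_false, add_zero]
        rw [← Complex.ofReal_sub, Complex.norm_real, Real.norm_eq_abs]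
        exact (min_le_left _ _).trans h1
  refine ⟨E, u, ContinuousLinearMap.isUnit_of_bounded_below (sub_pos.mpr hn) hlow
    (sub_pos.mpr hn) (by rwa [hEs]), by rw [hE, add_sub_cancel_right]⟩

end Limit

/-! ### Rank one perturbations of a unit -/

section RankOne

variable {E : H →L[ℂ] H} {u : H}

open LinearMap.FiniteRangeSetoid in
theorem isFredholm_sub_rankOne [CompleteSpace H] (hE : IsUnit E) :
    (E - rankOne ℂ u u).IsFredholm := by
  obtain ⟨e, rfl⟩ := hE
  set F := ContinuousLinearEquiv.ofUnit e
  have hq : LinearMap.IsQuasiInverse (F.symm : H →L[ℂ] H).toLinearMap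
      (F : H →L[ℂ] H).toLinearMap := F.toLinearEquiv.isQuasiInverse
  refine ContinuousLinearMap.IsFredholm.of_isQuasiInverse (v := (F.symm : H →L[ℂ] H)) ?_
  refine hq.congr (Setoid.refl _) ?_
  rw [LinearMap.FiniteRangeSetoid.equiv_iff_hasFiniteRange, LinearMap.hasFiniteRange_iff_range]
  refine Submodule.FG.of_le (Submodule.fg_span_singleton u) ?_
  rintro _ ⟨x, rfl⟩
  refine Submodule.mem_span_singleton.mpr ⟨-inner ℂ u x, ?_⟩
  have hFx : F x = (e : H →L[ℂ] H) x := rfl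
  simp [hFx]

/-- Kernel vectors are multiples of `w = E⁻¹ u`, and `w` lies in the kernel when `⟨u, w⟩ = 1`; any
other value would make the perturbation invertible. -/
theorem finrank_ker_sub_rankOne [CompleteSpace H] (hE : IsUnit E)
    (h : ¬ IsUnit (E - rankOne ℂ u u)) :
    Module.finrank ℂ (LinearMap.ker (E - rankOne ℂ u u : H →L[ℂ] H).toLinearMap) = 1 := by
  obtain ⟨hinj, hsurj⟩ := ContinuousLinearMap.isUnit_iff_bijective.mp hE
  obtain ⟨w, hw⟩ := hsurj u
  have hker : ∀ x, (E - rankOne ℂ u u) x = 0 → x = inner ℂ u x • w := by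
    intro x hx
    refine hinj ?_
    rw [map_smul, hw]
    simpa [sub_eq_zero] using hx
  have huw : inner ℂ u w = 1 := by
    by_contra hne
    have hne' : 1 - inner ℂ u w ≠ 0 := sub_ne_zero.mpr (Ne.symm hne)
    refine h (ContinuousLinearMap.isUnit_iff_bijective.mpr ⟨?_, fun y => ?_⟩)
    · refine (injective_iff_map_eq_zero _).mpr fun x hx => ?_
      have hx' := hker x hx
      have h1 : inner ℂ u x = inner ℂ u x * inner ℂ u w := by
        conv_lhs => rw [hx', inner_smul_right]
      have h2 : inner ℂ u x = 0 := by
        have : inner ℂ u x * (1 - inner ℂ u w) = 0 := by linear_combination h1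
        exact (mul_eq_zero.mp this).resolve_right hne'
      rw [hx', h2, zero_smul]
    · obtain ⟨y', rfl⟩ := hsurj y
      -- The Sherman–Morrison formula.
      refine ⟨y' + (inner ℂ u y' / (1 - inner ℂ u w)) • w, ?_⟩
      have hdiv : inner ℂ u y' / (1 - inner ℂ u w) * (1 - inner ℂ u w) = inner ℂ u y' :=
        div_mul_cancel₀ _ hne'
      generalize inner ℂ u y' / (1 - inner ℂ u w) = a at hdiv
      change E (y' + a • w) - inner ℂ u (y' + a • w) • u = E y'
      rw [map_add, map_smul, hw, inner_add_right, inner_smul_right, ← hdiv]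
      module
  refine finrank_eq_one_iff'.mpr ⟨⟨w, ?_⟩, ?_, ?_⟩
  · simp [hw, huw]
  · intro h0
    have : w = 0 := congrArg Subtype.val h0
    simp [this] at huw
  · rintro ⟨x, hx⟩
    exact ⟨inner ℂ u x, Subtype.ext (hker x hx).symm⟩

end RankOne

open scoped LinearMap.FiniteRangeSetoid in
/-- If infinitely many eigenvalues accumulate at `z`, the limit is not Fredholm at `z`. -/
theorem not_isFredholm_of_tendsto [CompleteSpace H]
    {S : ℕ → H →L[ℂ] H} {T : H →L[ℂ] H} {b : ℕ → HilbertBasis ι ℂ H} {lam : ι → ℝ}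
    (hSb : ∀ n, IsDiagonalIn (S n) (b n) (fun i => (lam i : ℂ)))
    (hT : Tendsto S atTop (𝓝 T)) {z : ℝ} (hz : ∀ ε > 0, {i | |lam i - z| < ε}.Infinite) :
    ¬ (T - (z : ℂ) • ContinuousLinearMap.id ℂ H).IsFredholm := by
  intro hF
  obtain ⟨v, hv⟩ := hF.exists_isQuasiInverse
  set R := T - (z : ℂ) • ContinuousLinearMap.id ℂ H with hR
  set K : H →ₗ[ℂ] H := LinearMap.id - v.toLinearMap ∘ₗ R.toLinearMap with hK
  have hKfin : K.HasFiniteRange := by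
    have h := hv.1
    rw [LinearMap.IsLeftQuasiInverse, Setoid.comm,
      LinearMap.FiniteRangeSetoid.equiv_iff_hasFiniteRange] at h
    exact h
  -- Chosen so that `‖v‖ * (2 * ε) < 1`; one `ε` pays for the eigenvalues near `z`, the other for
  -- `‖S n - T‖`.
  set ε : ℝ := 1 / (4 * (‖v‖ + 1)) with hε
  have hεpos : 0 < ε := by positivity
  obtain ⟨n, hn⟩ := ((tendsto_iff_norm_sub_tendsto_zero.mp hT).eventually_lt_const hεpos).exists
  set J := {i | |lam i - z| < ε}
  have hJ : Infinite J := (hz ε hεpos).to_subtype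
  have hli : LinearIndependent ℂ (fun i : J => b n i) :=
    (b n).orthonormal.linearIndependent.comp _ Subtype.val_injective
  -- A finite-range map cannot be injective on an infinite-dimensional span.
  have hnd : ¬ Disjoint (Submodule.span ℂ (Set.range fun i : J => b n i)) K.ker := by
    intro hd
    have hd' : Disjoint (Submodule.span ℂ (Set.range fun i : J => b n i)) K.rangeRestrict.ker := by
      rwa [LinearMap.ker_rangeRestrict]
    have hli' := hli.map hd'
    have : FiniteDimensional ℂ K.range :=
      Module.Finite.iff_fg.mpr hKfin.fg_range
    have : Finite J := hli'.finite
    exact not_finite J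
  rw [Submodule.disjoint_def] at hnd
  push Not at hnd
  obtain ⟨x, hxs, hxK, hx0⟩ := hnd
  have hxJ : ∀ i, inner ℂ (b n i) x ≠ 0 → i ∈ J := by
    intro i
    contrapose!
    intro hi
    clear hxK hx0
    induction hxs using Submodule.span_induction with
    | mem y hy =>
      obtain ⟨j, rfl⟩ := hy
      exact (b n).orthonormal.2 fun h => hi (h ▸ j.2)
    | zero => simp
    | add y y' _ _ h1 h2 => rw [inner_add_right, h1, h2, add_zero]
    | smul a y _ h1 => rw [inner_smul_right, h1, mul_zero]
  have h1 : ‖(S n - (z : ℂ) • ContinuousLinearMap.id ℂ H) x‖ ≤ ε * ‖x‖ := by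
    refine ((hSb n).sub_smul z).norm_le_mul hεpos.le fun i hi => ?_
    rw [← Complex.ofReal_sub, Complex.norm_real, Real.norm_eq_abs]
    exact (hxJ i hi).le
  have h2 : ‖R x‖ ≤ 2 * ε * ‖x‖ := by
    have e : R x = (S n - (z : ℂ) • ContinuousLinearMap.id ℂ H) x - (S n - T) x := by
      simp [hR]
    have h3 := (S n - T).le_opNorm x
    have h4 : ‖S n - T‖ * ‖x‖ ≤ ε * ‖x‖ := by gcongr
    rw [e]
    refine (norm_sub_le _ _).trans ?_
    linarith
  have h3 : x = v (R x) := by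
    simpa [hK, sub_eq_zero] using hxK
  have h4 : ‖x‖ ≤ ‖v‖ * (2 * ε * ‖x‖) := by
    conv_lhs => rw [h3]
    exact (v.le_opNorm _).trans (by gcongr)
  have hxpos : 0 < ‖x‖ := norm_pos_iff.mpr hx0
  have h5 : 1 ≤ ‖v‖ * (2 * ε) := by
    by_contra! hlt
    nlinarith
  have h6 : ε * (4 * (‖v‖ + 1)) = 1 := by
    rw [hε]; field_simp
  nlinarith [norm_nonneg v]

end DiagonalOperator

/-! ### Eigenbases of the approximants -/

section EllTwo

theorem HasStandardMatrix.isSelfAdjoint {S : EllTwo →L[ℂ] EllTwo} {M : Matrix ℕ ℕ ℝ}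
    (hS : HasStandardMatrix S M) (hM : M.IsSymm) : IsSelfAdjoint S := by
  refine lp.ext_continuousLinearMap (by norm_num) fun j => ?_
  ext i
  have h : ∀ x : EllTwo, inner ℂ (lp.single 2 i (1 : ℂ) : EllTwo) x = x i := fun x => by
    rw [lp.inner_single_left]; simp
  have h' : ∀ x : EllTwo, inner ℂ x (lp.single 2 j (1 : ℂ) : EllTwo) = starRingEnd ℂ (x j) :=
    fun x => by rw [lp.inner_single_right]; simp
  change (star S) (lp.single 2 j (1 : ℂ)) i = S (lp.single 2 j (1 : ℂ)) i
  rw [← h, ContinuousLinearMap.star_eq_adjoint, ContinuousLinearMap.adjoint_inner_right, h',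
    hS, hS, Complex.conj_ofReal, hM.apply]

theorem extendByDiagonal_isSymm {m : ℕ} {A : Matrix (Fin m) (Fin m) ℝ} (hA : A.IsSymm)
    (lam : ℕ → ℝ) : (extendByDiagonal A lam).IsSymm := by
  ext i j
  simp only [extendByDiagonal, Matrix.transpose_apply, Matrix.of_apply]
  by_cases h : i < m ∧ j < m
  · rw [dif_pos h, dif_pos h.symm, hA.apply]
  · rw [dif_neg h, dif_neg fun h' => h h'.symm]
    by_cases hij : i = j
    · simp [hij]
    · simp [hij, Ne.symm hij]

/-- Extension by zero of a real vector with `m` entries to a square-summable sequence. -/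
noncomputable def extendVector {m : ℕ} (v : Fin m → ℝ) : EllTwo :=
  ∑ j : Fin m, (v j : ℂ) • lp.single 2 (j : ℕ) (1 : ℂ)

theorem extendVector_apply {m : ℕ} (v : Fin m → ℝ) (j : Fin m) :
    extendVector v j = (v j : ℂ) := by
  simp only [extendVector, lp.coeFn_sum, Finset.sum_apply, lp.coeFn_smul, Pi.smul_apply,
    lp.single_apply, Pi.single_apply, Fin.val_inj]
  simp

theorem extendVector_apply_of_le {m : ℕ} (v : Fin m → ℝ) {k : ℕ} (hk : m ≤ k) :
    extendVector v k = 0 := by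
  simp only [extendVector, lp.coeFn_sum, Finset.sum_apply, lp.coeFn_smul, Pi.smul_apply,
    lp.single_apply, Pi.single_apply]
  refine Finset.sum_eq_zero fun j _ => ?_
  rw [if_neg (by omega), smul_zero]

theorem HasStandardMatrix.map_extendVector {m : ℕ} {A : Matrix (Fin m) (Fin m) ℝ} {lam : ℕ → ℝ}
    {S : EllTwo →L[ℂ] EllTwo} (hS : HasStandardMatrix S (extendByDiagonal A lam))
    (v : Fin m → ℝ) : S (extendVector v) = extendVector (A *ᵥ v) := by
  ext k
  have hk : S (extendVector v) k = ∑ j : Fin m, (v j : ℂ) * (extendByDiagonal A lam k j : ℂ) := by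
    simp only [extendVector, map_sum, map_smul, lp.coeFn_sum, Finset.sum_apply, lp.coeFn_smul,
      Pi.smul_apply, hS _ _, smul_eq_mul]
  rw [hk]
  by_cases h : k < m
  · rw [show extendVector (A *ᵥ v) k = _ from extendVector_apply _ ⟨k, h⟩, Matrix.mulVec,
      dotProduct, Complex.ofReal_sum]
    refine Finset.sum_congr rfl fun j _ => ?_
    simp [extendByDiagonal, h, mul_comm]
  · rw [extendVector_apply_of_le _ (not_lt.mp h)]
    refine Finset.sum_eq_zero fun j _ => ?_
    have : k ≠ j := by omega
    simp [extendByDiagonal, h, this]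

theorem HasStandardMatrix.map_single_of_le {m : ℕ} {A : Matrix (Fin m) (Fin m) ℝ} {lam : ℕ → ℝ}
    {S : EllTwo →L[ℂ] EllTwo} (hS : HasStandardMatrix S (extendByDiagonal A lam))
    {j : ℕ} (hj : m ≤ j) :
    S (lp.single 2 j (1 : ℂ)) = (lam j : ℂ) • lp.single 2 j (1 : ℂ) := by
  ext k
  rw [hS]
  simp only [extendByDiagonal, Matrix.of_apply, lp.coeFn_smul, Pi.smul_apply, lp.single_apply,
    Pi.single_apply]
  rw [dif_neg (by omega)]
  by_cases hkj : k = j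
  · simp [hkj]
  · simp [hkj]

theorem inner_extendVector {m : ℕ} (v : Fin m → ℝ) (x : EllTwo) :
    inner ℂ (extendVector v) x = ∑ j : Fin m, (v j : ℂ) * x j := by
  rw [extendVector, sum_inner]
  refine Finset.sum_congr rfl fun j _ => ?_
  rw [inner_smul_left, lp.inner_single_left]
  simp

/-- A vector orthogonal to a spanning family of real vectors vanishes. -/
theorem eq_zero_of_dotProduct_eq_zero {m : ℕ} {v : Fin m → Fin m → ℝ}
    (hv : Submodule.span ℝ (Set.range v) = ⊤) {r : Fin m → ℝ} (hr : ∀ i, v i ⬝ᵥ r = 0) :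
    r = 0 := by
  have key : ∀ y ∈ Submodule.span ℝ (Set.range v), y ⬝ᵥ r = 0 := by
    intro y hy
    induction hy using Submodule.span_induction with
    | mem y hy => obtain ⟨i, rfl⟩ := hy; exact hr i
    | zero => simp
    | add y y' _ _ h1 h2 => rw [add_dotProduct, h1, h2, add_zero]
    | smul a y _ h1 => rw [smul_dotProduct, h1, smul_zero]
  exact dotProduct_self_eq_zero.mp (key r (hv ▸ Submodule.mem_top))

/-- The eigenvectors of `A`, for distinct eigenvalues, together with the remaining standard basis
vectors, yield a Hilbert basis of eigenvectors of the operator extending `A` diagonally. -/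
theorem HasStandardMatrix.exists_hilbertBasis {m : ℕ} {A : Matrix (Fin m) (Fin m) ℝ}
    (hA : A.IsSymm) {lam : ℕ → ℝ} (hlam : Function.Injective lam)
    (hspec : spectrum ℝ A = Set.range (fun i : Fin m => lam i))
    {S : EllTwo →L[ℂ] EllTwo} (hS : HasStandardMatrix S (extendByDiagonal A lam)) :
    ∃ b : HilbertBasis ℕ ℂ EllTwo, ∀ i, S (b i) = (lam i : ℂ) • b i := by
  have hSs : IsSelfAdjoint S := hS.isSelfAdjoint (extendByDiagonal_isSymm hA lam)
  have hev : ∀ i : Fin m, ∃ v, Module.End.HasEigenvector (Matrix.toLin' A) (lam i) v := by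
    intro i
    refine Module.End.HasEigenvalue.exists_hasEigenvector ?_
    rw [Module.End.hasEigenvalue_iff_mem_spectrum, Matrix.spectrum_toLin', hspec]
    exact ⟨i, rfl⟩
  choose v hv using hev
  -- There are `m` distinct eigenvalues in dimension `m`.
  have hvspan : Submodule.span ℝ (Set.range v) = ⊤ := by
    refine LinearIndependent.span_eq_top_of_card_eq_finrank' ?_ (by simp)
    exact Module.End.eigenvectors_linearIndependent' (Matrix.toLin' A) (fun i : Fin m => lam i)
      (fun i j h => Fin.ext (hlam h)) v hv
  set w : ℕ → EllTwo := fun i =>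
    if h : i < m then extendVector (v ⟨i, h⟩) else lp.single 2 i (1 : ℂ) with hw
  have hSw : ∀ i, S (w i) = (lam i : ℂ) • w i := by
    intro i
    by_cases h : i < m
    · have h1 : A *ᵥ v ⟨i, h⟩ = lam i • v ⟨i, h⟩ := by
        simpa using (hv ⟨i, h⟩).apply_eq_smul
      simp only [hw, dif_pos h, hS.map_extendVector, h1]
      simp [extendVector, Finset.smul_sum, mul_smul]
    · simp only [hw, dif_neg h]
      exact hS.map_single_of_le (not_lt.mp h)
  have hw0 : ∀ i, w i ≠ 0 := by
    intro i h0
    by_cases h : i < m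
    · refine (hv ⟨i, h⟩).2 (funext fun j => ?_)
      have : (v ⟨i, h⟩ j : ℂ) = 0 := by
        rw [← extendVector_apply]
        simp only [hw, dif_pos h] at h0
        simp [h0]
      exact_mod_cast this
    · simp only [hw, dif_neg h] at h0
      have : (lp.single 2 i (1 : ℂ) : EllTwo) i = 0 := by simp [h0]
      simp at this
  have horth : ∀ i j, i ≠ j → inner ℂ (w i) (w j) = 0 := by
    intro i j hij
    have h1 : inner ℂ (S (w i)) (w j) = inner ℂ (w i) (S (w j)) := hSs.isSymmetric _ _
    rw [hSw, hSw, inner_smul_left, inner_smul_right, Complex.conj_ofReal] at h1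
    have h2 : ((lam i : ℂ) - lam j) * inner ℂ (w i) (w j) = 0 := by linear_combination h1
    refine (mul_eq_zero.mp h2).resolve_left fun h3 => hij (hlam ?_)
    exact_mod_cast sub_eq_zero.mp h3
  have hperp : ∀ x : EllTwo, (∀ i, inner ℂ (w i) x = 0) → x = 0 := by
    intro x hx
    have hfin : ∀ i : Fin m, ∑ j : Fin m, (v i j : ℂ) * x j = 0 := by
      intro i
      rw [← inner_extendVector]
      simpa [hw] using hx i
    -- The eigenvectors are real, so orthogonality holds for real and imaginary parts separately.
    have hre : (fun j : Fin m => (x j).re) = 0 := by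
      refine eq_zero_of_dotProduct_eq_zero hvspan fun i => ?_
      simpa [dotProduct] using congrArg Complex.re (hfin i)
    have him : (fun j : Fin m => (x j).im) = 0 := by
      refine eq_zero_of_dotProduct_eq_zero hvspan fun i => ?_
      simpa [dotProduct] using congrArg Complex.im (hfin i)
    ext k
    by_cases h : k < m
    · exact Complex.ext (congrFun hre ⟨k, h⟩) (congrFun him ⟨k, h⟩)
    · have := hx k
      simp only [hw, dif_neg h] at this
      rw [lp.inner_single_left] at this
      simpa using this
  have hON : Orthonormal ℂ fun i => ((‖w i‖⁻¹ : ℝ) : ℂ) • w i := by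
    refine ⟨fun i => ?_, fun i j hij => ?_⟩
    · have := norm_ne_zero_iff.mpr (hw0 i)
      simp [norm_smul, this]
    · simp only [inner_smul_left, inner_smul_right, horth i j hij, mul_zero]
  refine ⟨HilbertBasis.mkOfOrthogonalEqBot hON ?_, fun i => ?_⟩
  · rw [Submodule.eq_bot_iff]
    intro x hx
    refine hperp x fun i => ?_
    have h1 := (Submodule.mem_orthogonal _ _).mp hx _ (Submodule.subset_span ⟨i, rfl⟩)
    simp only [inner_smul_left, Complex.conj_ofReal] at h1
    refine (mul_eq_zero.mp h1).resolve_left ?_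
    have := norm_ne_zero_iff.mpr (hw0 i)
    exact_mod_cast inv_ne_zero this
  · rw [HilbertBasis.coe_mkOfOrthogonalEqBot, map_smul, hSw, smul_comm]

end EllTwo

/-! ### Limit points and isolated points of Λ -/

section RealSets

open Topology

variable {ι : Type*} {Λ : Set ℝ} {lam : ι → ℝ}

theorem infinite_abs_sub_lt_of_mem_derivedSet (hd : Λ ⊆ closure (Set.range lam)) {z : ℝ}
    (hz : z ∈ derivedSet Λ) {ε : ℝ} (hε : 0 < ε) : {i | |lam i - z| < ε}.Infinite := by
  intro hfin
  -- Were the set finite, deleting its values other than `z` from the ball would leave a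
  -- neighbourhood of `z`; density puts yet another value there.
  have hclosed : IsClosed (lam '' {i | |lam i - z| < ε} \ {z}) :=
    (hfin.image lam).sdiff.isClosed
  have hopen : IsOpen (Metric.ball z ε ∩ (lam '' {i | |lam i - z| < ε} \ {z})ᶜ) :=
    Metric.isOpen_ball.inter hclosed.isOpen_compl
  obtain ⟨y, ⟨hyU, hyΛ⟩, hyz⟩ := accPt_iff_nhds.mp hz _
    (hopen.mem_nhds ⟨Metric.mem_ball_self hε, by simp⟩)
  obtain ⟨_, ⟨hiU, hiz⟩, ⟨i, rfl⟩⟩ := mem_closure_iff.mp (hd hyΛ) _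
    (hopen.inter isOpen_compl_singleton) ⟨hyU, hyz⟩
  exact hiU.2 ⟨⟨i, hiU.1, rfl⟩, hiz⟩

/-- A dense subset contains every isolated point, and injectivity makes its index unique. -/
theorem exists_isolated_index (hlam : Function.Injective lam) (hmem : ∀ i, lam i ∈ Λ)
    (hd : Λ ⊆ closure (Set.range lam)) {μ : ℝ} (hμ : μ ∈ Λ \ derivedSet Λ) :
    ∃ k, lam k = μ ∧ ∃ δ > 0, ∀ i ≠ k, δ ≤ |lam i - lam k| := by
  have hacc : ¬ AccPt μ (Filter.principal Λ) := hμ.2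
  rw [accPt_iff_nhds] at hacc
  push Not at hacc
  obtain ⟨U, hU, hUΛ⟩ := hacc
  obtain ⟨δ, hδ, hball⟩ := Metric.mem_nhds_iff.mp hU
  obtain ⟨_, ⟨k, rfl⟩, hk⟩ := Metric.mem_closure_iff.mp (hd hμ.1) δ hδ
  have hkμ : lam k = μ := hUΛ _ ⟨hball (by rwa [Metric.mem_ball']), hmem k⟩
  refine ⟨k, hkμ, δ, hδ, fun i hik => ?_⟩
  by_contra! hlt
  exact hik (hlam ((hUΛ _ ⟨hball (by rwa [Metric.mem_ball, Real.dist_eq, ← hkμ]), hmem i⟩).trans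
    hkμ.symm))

end RealSets

/-! ### Assembly of the spectral statements -/

theorem mem_spectrum_iff_not_isUnit_sub_smul_id (T : EllTwo →L[ℂ] EllTwo) (z : ℂ) :
    z ∈ spectrum ℂ T ↔ ¬ IsUnit (T - z • ContinuousLinearMap.id ℂ EllTwo) := by
  rw [spectrum.mem_iff, Algebra.algebraMap_eq_smul_one, IsUnit.sub_iff]
  rfl

theorem mainTheorem5 (G : SimpleGraph ℕ) (Λ : Set ℝ) (hΛ : IsCompact Λ) (hΛinf : Λ.Infinite)
    (T : EllTwo →L[ℂ] EllTwo) (hT : IsConstructedSolution G Λ T) :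
    spectrum ℂ T = (fun x : ℝ => (x : ℂ)) '' Λ ∧
    spectrum ℂ T \ essentialSpectrum T = (fun x : ℝ => (x : ℂ)) '' (Λ \ derivedSet Λ) ∧
    ∀ μ ∈ Λ \ derivedSet Λ,
      Module.End.HasEigenvalue (T : EllTwo →ₗ[ℂ] EllTwo) (μ : ℂ) ∧
      Module.finrank ℂ
        (LinearMap.ker ((T - (μ : ℂ) • ContinuousLinearMap.id ℂ EllTwo : EllTwo →L[ℂ] EllTwo) :
          EllTwo →ₗ[ℂ] EllTwo)) = 1 := by
  obtain ⟨d, S, hS, hlim⟩ := hT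
  have hbasis := fun n =>
    (hS n).exists_hilbertBasis (d.A_symm n) d.lam_injective (d.A_spectrum n)
  choose b hb using hbasis
  have hSb : ∀ n, IsDiagonalIn (S n) (b n) (fun i => (d.lam i : ℂ)) := hb
  have hTs : IsSelfAdjoint T := isSelfAdjoint_of_tendsto
    (fun n => (hS n).isSelfAdjoint (extendByDiagonal_isSymm (d.A_symm n) d.lam)) hlim
  have hspec : spectrum ℂ T = (fun x : ℝ => (x : ℂ)) '' Λ := by
    apply Set.Subset.antisymm
    · intro z hz
      by_contra hzΛ
      have hclosed : IsClosed ((fun x : ℝ => (x : ℂ)) '' Λ) :=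
        (hΛ.image Complex.continuous_ofReal).isClosed
      obtain ⟨δ, hδ, hball⟩ := Metric.isOpen_iff.mp hclosed.isOpen_compl z hzΛ
      refine (mem_spectrum_iff_not_isUnit_sub_smul_id T z).mp hz
        (isUnit_sub_smul_of_tendsto hSb hTs hlim hδ fun i => ?_)
      by_contra! hlt
      exact hball (by rwa [Metric.mem_ball, dist_eq_norm]) ⟨d.lam i, d.lam_mem i, rfl⟩
    · have hclosed : IsClosed ((fun x : ℝ => (x : ℂ)) ⁻¹' spectrum ℂ T) :=
        (spectrum.isClosed T).preimage Complex.continuous_ofReal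
      have hrange : Set.range d.lam ⊆ (fun x : ℝ => (x : ℂ)) ⁻¹' spectrum ℂ T := by
        rintro _ ⟨i, rfl⟩
        exact (mem_spectrum_iff_not_isUnit_sub_smul_id T _).mpr
          (not_isUnit_sub_smul_of_tendsto hSb hlim i)
      exact Set.image_subset_iff.mpr (d.lam_dense.trans (hclosed.closure_subset_iff.mpr hrange))
  have hisol : ∀ μ ∈ Λ \ derivedSet Λ,
      (T - (μ : ℂ) • ContinuousLinearMap.id ℂ EllTwo).IsFredholm ∧
      Module.finrank ℂ
        (LinearMap.ker ((T - (μ : ℂ) • ContinuousLinearMap.id ℂ EllTwo : EllTwo →L[ℂ] EllTwo) :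
          EllTwo →ₗ[ℂ] EllTwo)) = 1 := by
    intro μ hμ
    obtain ⟨k, rfl, δ, hδ, hk⟩ := exists_isolated_index d.lam_injective d.lam_mem d.lam_dense hμ
    obtain ⟨E, u, hE, hTE⟩ := exists_isUnit_sub_rankOne_of_tendsto hSb hTs hlim hδ hk
    have hnu := not_isUnit_sub_smul_of_tendsto hSb hlim k
    rw [hTE] at hnu ⊢
    exact ⟨isFredholm_sub_rankOne hE, finrank_ker_sub_rankOne hE hnu⟩
  refine ⟨hspec, ?_, fun μ hμ => ⟨?_, (hisol μ hμ).2⟩⟩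
  · rw [hspec]
    ext z
    constructor
    · rintro ⟨⟨x, hx, rfl⟩, hess⟩
      refine ⟨x, ⟨hx, fun hacc => hess ?_⟩, rfl⟩
      exact not_isFredholm_of_tendsto hSb hlim fun ε hε =>
        infinite_abs_sub_lt_of_mem_derivedSet d.lam_dense hacc hε
    · rintro ⟨x, hx, rfl⟩
      exact ⟨⟨x, hx.1, rfl⟩, fun h => h (hisol x hx).1⟩
  · obtain ⟨⟨w, hw⟩, hw0, -⟩ := finrank_eq_one_iff'.mp (hisol μ hμ).2
    refine Module.End.hasEigenvalue_of_hasEigenvector (x := w)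
      ⟨Module.End.mem_eigenspace_iff.mpr ?_, fun h => hw0 (Subtype.ext h)⟩
    have : T w - (μ : ℂ) • w = 0 := hw
    exact sub_eq_zero.mp this
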